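/- Let $\mathbf{C}$ be a Markov category (a symmetric monoidal category in which every object carries a commutative comonoid structure $(\mathrm{copy},\mathrm{del})$ compatible with the tensor product, and whose monoidal unit $I$ is terminal) with conditionals: for every $f:A\to X\otimes Y$, with marginal $f_X:A\to X$, there is $f_{|X}:X\otimes A\to Y$ such that $f$ is obtained by copying $A$, applying $f_X$ to one copy, copying the resulting $X$, and applying $f_{|X}$ to one copy of $X$ and the remaining copy of $A$. For a state $p:I\to X$, morphisms $f,g:X\to Y$ are $p$-almost surely equal, $f\simeq_p g$, if $(\mathrm{id}_X\otimes f)\circ\mathrm{copy}_X\circ p=(\mathrm{id}_X\otimes g)\circ\mathrm{copy}_X\circ p$; and $f$ is $p$-almost surely deterministic if $\mathrm{copy}_Y\circ f\simeq_p (f\otimes f)\circ\mathrm{copy}_X$. Let $\mathbf{PS(C)}$ be the category whose objects are pairs $(X,p)$ of an object $X$ and a state $p:I\to X$ of $\mathbf{C}$, and whose morphisms $(X,p)\to(Y,q)$ are the morphisms $f:X\to Y$ of $\mathbf C$ with $f\circ p=q$, modulo $p$-almost sure equality. For $f:(X,p)\to(Y,q)$, let $f^\dagger:(Y,q)\to(X,p)$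 denote its Bayesian inverse, i.e. the (unique) morphism of $\mathbf{PS(C)}$ with $(f^\dagger\otimes \mathrm{id}_Y)\circ\mathrm{copy}_Y\circ q=(\mathrm{id}_X\otimes f)\circ\mathrm{copy}_X\circ p$. A dynamical system acting on $(X,p)$ is a functor $D$ from a monoid $M$ (seen as a one-object category) to $\mathbf{PS(C)}$ that maps the single object to $(X,p)$; write $m:(X,p)\to(X,p)$ for the action of $m\in M$, which need not be deterministic. A morphism $h$ into $(X,p)$ is left-invariant if $m\circ h=h$ in $\mathbf{PS(C)}$ for all $m\in M$. An invariant object of $D$ is a colimit $r:(X,p)\to(X_{\mathrm{inv}},p_{\mathrm{inv}})$ of $D$ in $\mathbf{PS(C)}$ such that, for every morphism $f$ out of $(X,p)$ with $f\circ m=f$ for all $m$, with factorization $f=\tilde f\circ r$, the morphism $f$ is almost surely deterministic if and only if $\tilde f$ is. A morphism $k:(A,b)\to(X,p)$ is almost surely ergodic if it is left-invariant and $r\circ k$ is $b$-almost surely deterministic. An ergodic decomposition of $g:(Y,q)\to(X,p)$ is a factorization $g=k\circ h$ in $\mathbf{PS(C)}$, with $h:(Y,q)\to(A,b)$, $k:(A,b)\to(X,p)$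 and $k$ almost surely ergodic. A reduction of a decomposition $(h,k)$ of $g$ through $(A,b)$ to a decomposition $(h',k')$ of $g$ through $(A',b')$ is an almost surely deterministic $d:(A,b)\to(A',b')$ with $k'\circ d=k$ and $d\circ h=h'$ in $\mathbf{PS(C)}$. Theorem. Suppose that every dynamical system in $\mathbf{PS(C)}$ (for every monoid) has an invariant object. Let $M$ be any monoid and $D:M\to\mathbf{PS(C)}$ a dynamical system acting on $(X,p)$, with invariant object $r:(X,p)\to(X_{\mathrm{inv}},p_{\mathrm{inv}})$. Then: 1. the morphism $r^\dagger:(X_{\mathrm{inv}},p_{\mathrm{inv}})\to(X,p)$ is almost surely ergodic; 2. every left-invariant morphism $g:(Y,q)\to(X,p)$ has an ergodic decomposition $g=r^\dagger\circ\tilde g$ for a unique $\tilde g:(Y,q)\to(X_{\mathrm{inv}},p_{\mathrm{inv}})$ of $\mathbf{PS(C)}$ (that is, unique up to $q$-almost sure equality); 3. for every left-invariant morphism $g:(Y,q)\to(X,p)$, every ergodic decomposition $(h,k)$ of $g$ has a unique reduction to the decomposition $(\tilde g,r^\dagger)$. -/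

import Mathlib

open CategoryTheory MonoidalCategory ComonObj CopyDiscardCategory

universe w v u

namespace ErgDec

section Markov

variable {C : Type u} [Category.{v} C] [MonoidalCategory C] [MarkovCategory C]

/-- `f` and `g` are `p`-almost surely equal: copying a `p`-distributed input and applying `f`,
respectively `g`, to one of the two copies gives the same joint state. -/
def AEEq {X Y : C} (p : 𝟙_ C ⟶ X) (f g : X ⟶ Y) : Prop :=
  p ≫ Δ[X] ≫ X ◁ f = p ≫ Δ[X] ≫ X ◁ g

/-- `f` is `p`-almost surely deterministic: it commutes with copying, `p`-almost surely. -/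
def AEDet {X Y : C} (p : 𝟙_ C ⟶ X) (f : X ⟶ Y) : Prop :=
  AEEq p (f ≫ Δ[Y]) (Δ[X] ≫ (f ⊗ₘ f))

variable (C) in
/-- Conditionals: every `f : A ⟶ X ⊗ Y` arises by copying `A`, producing `X` by the marginal of
`f`, copying `X`, and producing `Y` from `X` and `A` by a morphism `k : X ⊗ A ⟶ Y`. -/
class HasConditionals : Prop where
  exists_conditional {A X Y : C} (f : A ⟶ X ⊗ Y) : ∃ k : X ⊗ A ⟶ Y,
    f = Δ[A] ≫ (f ≫ X ◁ ε[Y] ≫ (ρ_ X).hom) ▷ A ≫ Δ[X] ▷ A ≫ (α_ X X A).hom ≫ X ◁ k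

variable (C) in
/-- Causality. -/
class IsCausal : Prop where
  causal {A W X Y : C} (f : A ⟶ W) (g : W ⟶ X) (h₁ h₂ : X ⟶ Y) :
    f ≫ g ≫ Δ[X] ≫ X ◁ h₁ = f ≫ g ≫ Δ[X] ≫ X ◁ h₂ →
    f ≫ Δ[W] ≫ W ◁ (g ≫ Δ[X] ≫ X ◁ h₁) = f ≫ Δ[W] ≫ W ◁ (g ≫ Δ[X] ≫ X ◁ h₂)

theorem copy_swap {X Y : C} (t : X ⟶ Y) :
    Δ[X] ≫ X ◁ t = Δ[X] ≫ t ▷ X ≫ (β_ Y X).hom := by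
  rw [BraidedCategory.braiding_naturality_left, IsCommComonObj.comul_comm_assoc]

theorem copy_graph {X Y : C} (h : X ⟶ Y) :
    Δ[X] ≫ (Δ[X] ≫ X ◁ h) ▷ X =
      (Δ[X] ≫ X ◁ h) ≫ Δ[X] ▷ Y ≫ (α_ X X Y).hom ≫ X ◁ (β_ X Y).hom ≫ (α_ X Y X).inv := by
  have e : (X ◁ h) ≫ Δ[X] ▷ Y = Δ[X] ▷ X ≫ (X ⊗ X) ◁ h := by rw [whisker_exchange]
  have e2 : Δ[X] ≫ Δ[X] ▷ X ≫ (α_ X X X).hom ≫ X ◁ (β_ X X).hom ≫ (α_ X X X).inv =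
      Δ[X] ≫ Δ[X] ▷ X := by
    have := ComonObj.comul_assoc X
    rw [← Category.assoc (Δ[X])] at this
    have h3 : Δ[X] ≫ Δ[X] ▷ X = Δ[X] ≫ X ◁ Δ[X] ≫ (α_ X X X).inv := by
      rw [← Category.assoc, this]; simp
    rw [reassoc_of% h3]
    simp only [Iso.inv_hom_id_assoc]
    rw [← whiskerLeft_comp_assoc, IsCommComonObj.comul_comm]
    exact h3.symm
  have e3 : (X ⊗ X) ◁ h ≫ (α_ X X Y).hom ≫ X ◁ (β_ X Y).hom ≫ (α_ X Y X).inv =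
      (α_ X X X).hom ≫ X ◁ (β_ X X).hom ≫ (α_ X X X).inv ≫ (X ◁ h) ▷ X := by
    have n : X ◁ h ≫ (β_ X Y).hom = (β_ X X).hom ≫ h ▷ X :=
      BraidedCategory.braiding_naturality_right X h
    have n' := congrArg (fun t => X ◁ t) n
    simp only [whiskerLeft_comp] at n'
    simp [reassoc_of% n']
  rw [Category.assoc, reassoc_of% e, e3, reassoc_of% e2, comp_whiskerRight]

instance [HasConditionals C] : IsCausal C where
  causal {A W X Y} f g h₁ h₂ H := by
    obtain ⟨k, hk⟩ := HasConditionals.exists_conditional (f ≫ Δ[W] ≫ g ▷ W)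
    have hm : (f ≫ Δ[W] ≫ g ▷ W) ≫ X ◁ ε[W] ≫ (ρ_ X).hom = f ≫ g := by
      simp only [Category.assoc, ← whisker_exchange_assoc, comul_counit_assoc]
      simp
    rw [hm] at hk
    have key : ∀ h : X ⟶ Y, f ≫ Δ[W] ≫ W ◁ (g ≫ Δ[X] ≫ X ◁ h) =
        Δ[A] ≫ ((f ≫ g ≫ Δ[X] ≫ X ◁ h) ≫ Δ[X] ▷ Y ≫ (α_ X X Y).hom ≫
          X ◁ (β_ X Y).hom ≫ (α_ X Y X).inv) ▷ A ≫ (α_ (X ⊗ Y) X A).hom ≫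
          (X ⊗ Y) ◁ k ≫ (β_ (X ⊗ Y) W).hom := by
      intro h
      have h4 := copy_graph h
      simp only [Category.assoc] at h4 ⊢
      rw [← h4, copy_swap]
      have h5 : f ≫ Δ[W] ≫ (g ≫ Δ[X] ≫ X ◁ h) ▷ W ≫ (β_ (X ⊗ Y) W).hom =
          (f ≫ Δ[W] ≫ g ▷ W) ≫ (Δ[X] ≫ X ◁ h) ▷ W ≫ (β_ (X ⊗ Y) W).hom := by simp
      rw [h5, hk]
      simp only [Category.assoc]
      rw [whisker_exchange_assoc]
      simp
    rw [key, key, H]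

theorem AEEq.comp [IsCausal C] {X Y Z : C} {p : 𝟙_ C ⟶ X} {f f' : X ⟶ Y} {g g' : Y ⟶ Z}
    (hf : AEEq p f f') (hg : AEEq (p ≫ f) g g') : AEEq p (f ≫ g) (f' ≫ g') := by
  have h1 := IsCausal.causal p f g g' (by simpa [AEEq] using hg)
  have h2 := h1 =≫ X ◁ (ε[Y] ▷ Z ≫ (λ_ Z).hom)
  have e : ∀ g : Y ⟶ Z, (f ≫ Δ[Y] ≫ Y ◁ g) ≫ ε[Y] ▷ Z ≫ (λ_ Z).hom = f ≫ g := by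
    intro g
    simp only [Category.assoc, whisker_exchange_assoc, counit_comul_assoc]
    simp
  simp only [Category.assoc, ← whiskerLeft_comp] at h2
  simp only [Category.assoc] at e
  rw [e, e] at h2
  have h3 := hf =≫ X ◁ g'
  simp only [Category.assoc, ← whiskerLeft_comp] at h3
  exact h2.trans h3

theorem AEEq.tensor_copy {X Y : C} {p : 𝟙_ C ⟶ X} {f f' : X ⟶ Y}
    (hf : AEEq p f f') : AEEq p (Δ[X] ≫ (f ⊗ₘ f)) (Δ[X] ≫ (f' ⊗ₘ f')) := by
  have a : ∀ s t : X ⟶ Y, Δ[X] ≫ X ◁ (Δ[X] ≫ (s ⊗ₘ t)) =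
      (Δ[X] ≫ X ◁ t) ≫ Δ[X] ▷ Y ≫ (X ◁ s) ▷ Y ≫ (α_ X Y Y).hom := by
    intro s t
    rw [MonoidalCategory.tensorHom_def]
    simp only [whiskerLeft_comp, Category.assoc, comul_assoc_assoc, whisker_exchange_assoc]
    simp
  have b : ∀ s t : X ⟶ Y, Δ[X] ≫ X ◁ (Δ[X] ≫ (s ⊗ₘ t)) =
      (Δ[X] ≫ X ◁ (Δ[X] ≫ (t ⊗ₘ s))) ≫ X ◁ (β_ Y Y).hom := by
    intro s t
    rw [Category.assoc, ← whiskerLeft_comp, Category.assoc, BraidedCategory.braiding_naturality,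
      IsCommComonObj.comul_comm_assoc]
  have c : ∀ s t t' : X ⟶ Y, AEEq p t t' → AEEq p (Δ[X] ≫ (s ⊗ₘ t)) (Δ[X] ≫ (s ⊗ₘ t')) := by
    intro s t t' h
    have := h =≫ (Δ[X] ▷ Y ≫ (X ◁ s) ▷ Y ≫ (α_ X Y Y).hom)
    simp only [Category.assoc] at this
    simp only [AEEq, a, Category.assoc]
    exact this
  refine (c f f f' hf).trans ?_
  have := (c f' f f' hf) =≫ X ◁ (β_ Y Y).hom
  rw [b f f', b f' f']
  simpa only [Category.assoc] using this

theorem AEDet.congr {X Y : C} {p : 𝟙_ C ⟶ X} {f f' : X ⟶ Y}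
    (hf : AEEq p f f') (h : AEDet p f) : AEDet p f' := by
  have h1 : AEEq p (f ≫ Δ[Y]) (f' ≫ Δ[Y]) := by
    have := hf =≫ X ◁ Δ[Y]
    simpa [AEEq] using this
  exact (h1.symm.trans h).trans hf.tensor_copy

end Markov

/-- Probability spaces in a Markov category: an object together with a state on it. -/
structure PS (C : Type u) [Category.{v} C] [MonoidalCategory C] where
  carrier : C
  state : 𝟙_ C ⟶ carrier

namespace PS

variable {C : Type u} [Category.{v} C] [MonoidalCategory C] [MarkovCategory C]

/-- State-preserving morphisms. -/
def PreHom (P Q : PS C) : Type v :=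
  {f : P.carrier ⟶ Q.carrier // P.state ≫ f = Q.state}

/-- Almost sure equality of state-preserving morphisms. -/
instance homSetoid (P Q : PS C) : Setoid (PreHom P Q) where
  r f g := AEEq P.state f.1 g.1
  iseqv := ⟨fun _ => rfl, fun h => Eq.symm h, fun h h' => Eq.trans h h'⟩

/-- The category of probability spaces in `C`: morphisms are the state-preserving morphisms of `C`
modulo almost sure equality. -/
instance category [IsCausal C] : Category.{v} (PS C) where
  Hom P Q := Quotient (homSetoid P Q)
  id P := Quotient.mk _ ⟨𝟙 P.carrier, Category.comp_id _⟩
  comp {P Q R} f g := Quotient.map₂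
    (fun (f : PreHom P Q) (g : PreHom Q R) =>
      (⟨f.1 ≫ g.1, by rw [← Category.assoc, f.2, g.2]⟩ : PreHom P R))
    (fun f f' hf g g' hg => by
      refine AEEq.comp (C := C) hf ?_
      rw [f.2]
      exact hg) f g
  id_comp f := by
    induction f using Quotient.inductionOn with
    | h f => exact congrArg (Quotient.mk _) (Subtype.ext (Category.id_comp _))
  comp_id f := by
    induction f using Quotient.inductionOn with
    | h f => exact congrArg (Quotient.mk _) (Subtype.ext (Category.comp_id _))
  assoc f g h := by
    induction f using Quotient.inductionOn with
    | h f =>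
      induction g using Quotient.inductionOn with
      | h g =>
        induction h using Quotient.inductionOn with
        | h h => exact congrArg (Quotient.mk _) (Subtype.ext (Category.assoc _ _ _))

variable [IsCausal C]

/-- Almost sure determinism of a morphism of `PS C`. -/
def IsDet {P Q : PS C} (f : P ⟶ Q) : Prop :=
  Quotient.liftOn (s := homSetoid P Q) f (fun f₀ => AEDet P.state f₀.1) fun _ _ h =>
    propext ⟨AEDet.congr h, AEDet.congr (Eq.symm h)⟩

/-- The joint state on `P ⊗ Q` obtained by copying the state of `P` and applying `f` to one of the
two copies. -/
def joint {P Q : PS C} (f : P ⟶ Q) : 𝟙_ C ⟶ P.carrier ⊗ Q.carrier :=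
  Quotient.liftOn (s := homSetoid P Q) f
    (fun f₀ => P.state ≫ Δ[P.carrier] ≫ P.carrier ◁ f₀.1) fun _ _ h => h

/-- `g` is a Bayesian inverse of `f`: the two have the same joint state, up to swapping. -/
def IsBayesianInverse {P Q : PS C} (f : P ⟶ Q) (g : Q ⟶ P) : Prop :=
  joint g ≫ (β_ Q.carrier P.carrier).hom = joint f

theorem joint_injective {P Q : PS C} {f g : P ⟶ Q} (h : joint f = joint g) : f = g := by
  induction f using Quotient.inductionOn with
  | h f =>
    induction g using Quotient.inductionOn with
    | h g => exact Quotient.sound h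

theorem IsBayesianInverse.unique {P Q : PS C} {f : P ⟶ Q} {g g' : Q ⟶ P}
    (h : IsBayesianInverse f g) (h' : IsBayesianInverse f g') : g = g' := by
  apply joint_injective
  have := Eq.trans h (Eq.symm h')
  exact (cancel_mono _).1 this

theorem exists_isBayesianInverse [HasConditionals C] {P Q : PS C} (f : P ⟶ Q) :
    ∃ g : Q ⟶ P, IsBayesianInverse f g := by
  induction f using Quotient.inductionOn with
  | h f =>
    obtain ⟨X, p⟩ := P
    obtain ⟨Y, q⟩ := Q
    obtain ⟨f, hf⟩ := f
    dsimp at f hf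
    obtain ⟨k, hk⟩ := HasConditionals.exists_conditional (p ≫ Δ[X] ≫ f ▷ X)
    have hm : (p ≫ Δ[X] ≫ f ▷ X) ≫ Y ◁ ε[X] ≫ (ρ_ Y).hom = q := by
      simp only [Category.assoc, ← whisker_exchange_assoc, comul_counit_assoc]
      simpa using hf
    rw [hm, copy_unit] at hk
    have h1 : p ≫ Δ[X] ≫ f ▷ X = q ≫ Δ[Y] ≫ Y ◁ ((ρ_ Y).inv ≫ k) := by
      rw [hk]
      simp [unitors_inv_equal]
    have h2 : q ≫ (ρ_ Y).inv ≫ k = p := by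
      have := h1 =≫ (ε[Y] ▷ X ≫ (λ_ X).hom)
      simp only [Category.assoc, whisker_exchange_assoc, counit_comul_assoc] at this
      rw [leftUnitor_naturality, Iso.inv_hom_id_assoc] at this
      rw [← comp_whiskerRight_assoc, MarkovCategory.discard_natural, counit_comul_assoc] at this
      simpa using this.symm
    refine ⟨Quotient.mk _ ⟨(ρ_ Y).inv ≫ k, h2⟩, ?_⟩
    change (q ≫ Δ[Y] ≫ Y ◁ ((ρ_ Y).inv ≫ k)) ≫ (β_ Y X).hom = p ≫ Δ[X] ≫ X ◁ f
    rw [← h1, copy_swap]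
    simp

/-- The dagger of `PS C`: the Bayesian inverse. -/
noncomputable def dagger [HasConditionals C] {P Q : PS C} (f : P ⟶ Q) : Q ⟶ P :=
  (exists_isBayesianInverse f).choose

theorem dagger_isBayesianInverse [HasConditionals C] {P Q : PS C} (f : P ⟶ Q) :
    IsBayesianInverse f (dagger f) :=
  (exists_isBayesianInverse f).choose_spec

end PS

section Dynamics

variable {C : Type u} [Category.{v} C] [MonoidalCategory C] [MarkovCategory C] [IsCausal C]

/-- A dynamical system in `PS C` with monoid `M`: a functor from the one-object category of `M`.
An element `m` acts as `D.map m`. -/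
abbrev DynSystem (C : Type u) [Category.{v} C] [MonoidalCategory C] [MarkovCategory C]
    [IsCausal C] (M : Type w) [Monoid M] :=
  SingleObj M ⥤ PS C

variable {M : Type w} [Monoid M]

namespace DynSystem

/-- The probability space acted upon. -/
abbrev space (D : DynSystem C M) : PS C := D.obj (SingleObj.star M)

/-- The morphism by which `m : M` acts. -/
abbrev act (D : DynSystem C M) (m : M) : D.space ⟶ D.space :=
  D.map (SingleObj.toEnd M m)

/-- `h` is left-invariant: `m ∘ h = h` for all `m`. -/
def LeftInvariant (D : DynSystem C M) {A : PS C} (h : A ⟶ D.space) : Prop :=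
  ∀ m : M, h ≫ D.act m = h

/-- The single leg of a cocone over a dynamical system. -/
abbrev leg {D : DynSystem C M} (c : Limits.Cocone D) : D.space ⟶ c.pt :=
  c.ι.app (SingleObj.star M)

/-- `c` is an invariant object of `D`: a colimit of `D`, such that an invariant morphism is almost
surely deterministic iff its factorization through the colimit is. -/
structure IsInvariantObject {D : DynSystem C M} (c : Limits.Cocone D) : Prop where
  isColimit : Nonempty (Limits.IsColimit c)
  det_iff : ∀ (s : Limits.Cocone D) (f : c.pt ⟶ s.pt), leg c ≫ f = leg s →
    (PS.IsDet (leg s) ↔ PS.IsDet f)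

end DynSystem

variable (C) in
/-- All invariant objects of `PS C` exist (for monoids in the universe `w`). -/
def HasInvariantObjects : Prop :=
  ∀ (M : Type w) [Monoid M] (D : DynSystem C M),
    ∃ c : Limits.Cocone D, DynSystem.IsInvariantObject c

/-- `k : A ⟶ (X, p)` is almost surely ergodic for `D`, with respect to the invariant object `c`. -/
structure IsErgodic {D : DynSystem C M} (c : Limits.Cocone D) {A : PS C} (k : A ⟶ D.space) :
    Prop where
  det : PS.IsDet (k ≫ DynSystem.leg c)
  leftInvariant : D.LeftInvariant k

/-- A decomposition of `f`: a factorization through some probability space. -/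
structure Decomposition {P Q : PS C} (f : P ⟶ Q) where
  mid : PS C
  fst : P ⟶ mid
  snd : mid ⟶ Q
  fac : fst ≫ snd = f

/-- `d` exhibits `E'` as a reduction of `E`. -/
structure Decomposition.IsReduction {P Q : PS C} {f : P ⟶ Q} (E E' : Decomposition f)
    (d : E.mid ⟶ E'.mid) : Prop where
  det : PS.IsDet d
  snd_eq : d ≫ E'.snd = E.snd
  fst_eq : E.fst ≫ d = E'.fst

/-- An ergodic decomposition: the second factor is almost surely ergodic. -/
def Decomposition.Ergodic {D : DynSystem C M} (c : Limits.Cocone D) {P : PS C}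
    {g : P ⟶ D.space} (E : Decomposition g) : Prop :=
  IsErgodic c E.snd

end Dynamics

end ErgDec

/-!
Bayesian inversion makes `PS C` a dagger category, in which every almost surely deterministic `r`
satisfies `r ∘ r† = id`. Causality yields a converse: if `g ∘ f = id`, then `g = f†`. So if
`r` is almost surely deterministic and `r ∘ m = r`, then
`(r ∘ m†) ∘ r† = r ∘ (r ∘ m)† = r ∘ r† = id` forces `r ∘ m† = r†† = r`.

Hence `D` and its reversal, in which `m` acts by `m†`, have the same almost surely deterministic
invariant observables, and the invariant object of the reversal factors through that of `D`. A
morphism `g` is left-invariant under `D` if and only if `g†` is invariant under the reversal, in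
which case `g†` factors through `r`, that is, `g = r† ∘ h`. Then `h = r ∘ g`, as `r ∘ r† = id`.
-/

namespace ErgDec

section Markov

variable {C : Type u} [Category.{v} C] [MonoidalCategory C] [MarkovCategory C]

theorem copy_comp_copy_tensor_copy (X : C) :
    Δ[X] ≫ (Δ[X] ⊗ₘ Δ[X]) =
      Δ[X] ≫ X ◁ (Δ[X] ≫ Δ[X] ▷ X ≫ (α_ X X X).hom) ≫ (α_ X X (X ⊗ X)).inv := by
  rw [← cancel_mono (α_ X X (X ⊗ X)).hom]
  simp only [MonoidalCategory.tensorHom_def, Category.assoc, Iso.inv_hom_id, Category.comp_id,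
    ← comul_assoc]
  rw [associator_naturality_right, ← comul_assoc_assoc, whiskerLeft_comp]

instance deterministic_copy (X : C) : Deterministic Δ[X] := by
  -- Instance search would put the comonoid structure of `Comon C` on `X ⊗ X`.
  refine @IsComonHom.mk C _ _ X (X ⊗ X) (comonObj X) (comonObj (X ⊗ X)) _
    (MarkovCategory.discard_natural _) ?_
  -- By cocommutativity, exchanging the two middle copies of four changes nothing.
  have swap_middle : X ◁ Δ[X] ▷ X ≫ X ◁ (β_ X X).hom ▷ X = X ◁ Δ[X] ▷ X := by
    rw [← whiskerLeft_comp, ← comp_whiskerRight, IsCommComonObj.comul_comm]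
  rw [copy_tensor, tensorμ, reassoc_of% (copy_comp_copy_tensor_copy X),
    copy_comp_copy_tensor_copy X]
  simp only [whiskerLeft_comp, Category.assoc, Iso.inv_hom_id_assoc,
    whiskerLeft_hom_inv_assoc, reassoc_of% swap_middle]

theorem AEEq.state_comp_eq {X Y : C} {p : 𝟙_ C ⟶ X} {f g : X ⟶ Y} (h : AEEq p f g) :
    p ≫ f = p ≫ g := by
  have forget_input (k : X ⟶ Y) : (p ≫ Δ[X] ≫ X ◁ k) ≫ ε[X] ▷ Y ≫ (λ_ Y).hom = p ≫ k := by
    simp only [Category.assoc, whisker_exchange_assoc, counit_comul_assoc, leftUnitor_naturality,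
      Iso.inv_hom_id_assoc]
  rw [← forget_input f, ← forget_input g, h]

theorem AEDet.state_copy {X Y : C} {p : 𝟙_ C ⟶ X} {f : X ⟶ Y} (hf : AEDet p f) :
    p ≫ Δ[X] ≫ (f ⊗ₘ f) = (p ≫ f) ≫ Δ[Y] := by
  rw [Category.assoc]
  exact hf.state_comp_eq.symm

theorem AEEq.of_deterministic_comp {X Y Z : C} {p : 𝟙_ C ⟶ X} (f : X ⟶ Y) [Deterministic f]
    {g g' : Y ⟶ Z} (h : AEEq p (f ≫ g) (f ≫ g')) : AEEq (p ≫ f) g g' := by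
  have graph (k : Y ⟶ Z) :
      (p ≫ f) ≫ Δ[Y] ≫ Y ◁ k = (p ≫ Δ[X] ≫ X ◁ (f ≫ k)) ≫ f ▷ Z := by
    rw [Category.assoc, reassoc_of% (Deterministic.copy_natural f),
      MonoidalCategory.tensorHom_def]
    simp only [Category.assoc, whiskerLeft_comp, ← whisker_exchange]
  rw [AEEq, graph, graph, h]

/-- The two projections of `X ⊗ X` agree almost surely under a copied state; causality transports
this along `Δ[Y] ≫ (f ⊗ₘ g)`. -/
theorem AEEq.of_copy_tensor_eq_copy [IsCausal C] {X Y : C} {p : 𝟙_ C ⟶ X} {q : 𝟙_ C ⟶ Y}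
    {f g : Y ⟶ X} (h : q ≫ Δ[Y] ≫ (f ⊗ₘ g) = p ≫ Δ[X]) : AEEq q f g := by
  have fst_snd : AEEq (p ≫ Δ[X]) (X ◁ ε[X] ≫ (ρ_ X).hom) (ε[X] ▷ X ≫ (λ_ X).hom) :=
    .of_deterministic_comp Δ[X] (by simp [AEEq])
  rw [← h] at fst_snd
  have comp_fst : (Δ[Y] ≫ (f ⊗ₘ g)) ≫ X ◁ ε[X] ≫ (ρ_ X).hom = f := by
    simp [tensorHom_comp_whiskerLeft_assoc]
  have comp_snd : (Δ[Y] ≫ (f ⊗ₘ g)) ≫ ε[X] ▷ X ≫ (λ_ X).hom = g := by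
    simp [tensorHom_comp_whiskerRight_assoc]
  have pulled_back := AEEq.comp (p := q) (f := Δ[Y] ≫ (f ⊗ₘ g)) rfl fst_snd
  rwa [comp_fst, comp_snd] at pulled_back

end Markov

namespace PS

variable {C : Type u} [Category.{v} C] [MonoidalCategory C] [MarkovCategory C]

section Causal

variable [IsCausal C] {P Q R : PS C}

/-- The morphism of `PS C` represented by a state-preserving morphism of `C`. -/
def homMk (f : P.carrier ⟶ Q.carrier) (h : P.state ≫ f = Q.state) : P ⟶ Q :=
  Quotient.mk (homSetoid P Q) ⟨f, h⟩

theorem exists_homMk_eq (f : P ⟶ Q) : ∃ f₀ h, homMk f₀ h = f := by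
  induction f using Quotient.inductionOn with
  | h f => exact ⟨f.1, f.2, rfl⟩

theorem homMk_eq_homMk {f g : P.carrier ⟶ Q.carrier} {hf : P.state ≫ f = Q.state}
    {hg : P.state ≫ g = Q.state} (h : AEEq P.state f g) : homMk f hf = homMk g hg :=
  Quotient.sound h

theorem joint_homMk (f : P.carrier ⟶ Q.carrier) (h : P.state ≫ f = Q.state) :
    joint (homMk f h) = P.state ≫ Δ[P.carrier] ≫ P.carrier ◁ f := rfl

theorem joint_id (P : PS C) : joint (𝟙 P) = P.state ≫ Δ[P.carrier] := by
  change P.state ≫ Δ[P.carrier] ≫ P.carrier ◁ 𝟙 _ = _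
  rw [whiskerLeft_id, Category.comp_id]

theorem joint_comp_homMk (f : P ⟶ Q) (g : Q.carrier ⟶ R.carrier) (h : Q.state ≫ g = R.state) :
    joint (f ≫ homMk g h) = joint f ≫ P.carrier ◁ g := by
  obtain ⟨f, hf, rfl⟩ := exists_homMk_eq f
  change P.state ≫ Δ[P.carrier] ≫ P.carrier ◁ (f ≫ g) = _
  simp only [joint_homMk, whiskerLeft_comp, Category.assoc]

theorem isDet_homMk {f : P.carrier ⟶ Q.carrier} {h : P.state ≫ f = Q.state} :
    IsDet (homMk f h) ↔ AEDet P.state f := Iff.rfl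

theorem isDet_id (P : PS C) : IsDet (𝟙 P) := by
  change AEEq P.state (𝟙 _ ≫ Δ[P.carrier]) (Δ[P.carrier] ≫ (𝟙 _ ⊗ₘ 𝟙 _))
  rw [id_tensorHom_id, Category.id_comp, Category.comp_id, AEEq]

theorem isBayesianInverse_homMk {f : P ⟶ Q} {g : Q.carrier ⟶ P.carrier}
    {h : Q.state ≫ g = P.state} :
    IsBayesianInverse f (homMk g h) ↔ Q.state ≫ Δ[Q.carrier] ≫ g ▷ Q.carrier = joint f := by
  rw [IsBayesianInverse, joint_homMk, copy_swap]
  simp only [Category.assoc, SymmetricCategory.symmetry, Category.comp_id]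

namespace IsBayesianInverse

theorem symm {f : P ⟶ Q} {g : Q ⟶ P} (h : IsBayesianInverse f g) : IsBayesianInverse g f := by
  unfold IsBayesianInverse at *
  rw [← h, Category.assoc, SymmetricCategory.symmetry, Category.comp_id]

theorem id (P : PS C) : IsBayesianInverse (𝟙 P) (𝟙 P) := by
  rw [IsBayesianInverse, joint_id, Category.assoc, IsCommComonObj.comul_comm]

theorem comp {f : P ⟶ Q} {f' : Q ⟶ P} {g : Q ⟶ R} {g' : R ⟶ Q}
    (hf : IsBayesianInverse f f') (hg : IsBayesianInverse g g') :
    IsBayesianInverse (f ≫ g) (g' ≫ f') := by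
  obtain ⟨f', hf', rfl⟩ := exists_homMk_eq f'
  obtain ⟨g, hg₀, rfl⟩ := exists_homMk_eq g
  calc joint (g' ≫ homMk f' hf') ≫ (β_ R.carrier P.carrier).hom
      = Q.state ≫ Δ[Q.carrier] ≫ g ▷ Q.carrier ≫ R.carrier ◁ f' ≫
          (β_ R.carrier P.carrier).hom := by
        rw [joint_comp_homMk, ← isBayesianInverse_homMk.1 hg.symm]
        simp only [Category.assoc]
    _ = Q.state ≫ Δ[Q.carrier] ≫ f' ▷ Q.carrier ≫ P.carrier ◁ g := by
        rw [BraidedCategory.braiding_naturality_right,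
          BraidedCategory.braiding_naturality_left_assoc, IsCommComonObj.comul_comm_assoc,
          whisker_exchange]
    _ = joint (f ≫ homMk g hg₀) := by
        rw [joint_comp_homMk, ← isBayesianInverse_homMk.1 hf]
        simp only [Category.assoc]

theorem comp_eq_id_of_isDet {f : P ⟶ Q} {g : Q ⟶ P} (h : IsBayesianInverse f g)
    (hf : IsDet f) : g ≫ f = 𝟙 Q := by
  apply joint_injective
  obtain ⟨f, hf₀, rfl⟩ := exists_homMk_eq f
  rw [joint_comp_homMk, ← isBayesianInverse_homMk.1 h.symm, joint_id, ← hf₀,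
    ← (isDet_homMk.1 hf).state_copy, MonoidalCategory.tensorHom_def]
  simp only [Category.assoc]

/-- Under the state of `Q`, the pair `(f', g)` has the joint law of `(𝟙, f ≫ g)` under the state
of `P`, which is diagonal. -/
theorem eq_of_comp_eq_id {f : P ⟶ Q} {f' g : Q ⟶ P} (hf : IsBayesianInverse f f')
    (h : f ≫ g = 𝟙 P) : f' = g := by
  obtain ⟨f', hf', rfl⟩ := exists_homMk_eq f'
  obtain ⟨g, hg, rfl⟩ := exists_homMk_eq g
  have diagonal : Q.state ≫ Δ[Q.carrier] ≫ (f' ⊗ₘ g) = P.state ≫ Δ[P.carrier] := by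
    rw [← joint_id, ← h, joint_comp_homMk, ← isBayesianInverse_homMk.1 hf,
      MonoidalCategory.tensorHom_def]
    simp only [Category.assoc]
  exact homMk_eq_homMk (.of_copy_tensor_eq_copy diagonal)

end IsBayesianInverse

end Causal

section Dagger

variable [HasConditionals C] {P Q R : PS C}

theorem dagger_eq {f : P ⟶ Q} {g : Q ⟶ P} (h : IsBayesianInverse f g) : dagger f = g :=
  (dagger_isBayesianInverse f).unique h

theorem dagger_dagger (f : P ⟶ Q) : dagger (dagger f) = f :=
  dagger_eq (dagger_isBayesianInverse f).symm

theorem dagger_id (P : PS C) : dagger (𝟙 P) = 𝟙 P :=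
  dagger_eq (.id P)

theorem dagger_comp (f : P ⟶ Q) (g : Q ⟶ R) : dagger (f ≫ g) = dagger g ≫ dagger f :=
  dagger_eq ((dagger_isBayesianInverse f).comp (dagger_isBayesianInverse g))

theorem dagger_eq_of_comp_eq_id {f : P ⟶ Q} {g : Q ⟶ P} (h : f ≫ g = 𝟙 P) : dagger f = g :=
  (dagger_isBayesianInverse f).eq_of_comp_eq_id h

theorem IsDet.dagger_comp_self {f : P ⟶ Q} (hf : IsDet f) : dagger f ≫ f = 𝟙 Q :=
  (dagger_isBayesianInverse f).comp_eq_id_of_isDet hf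

theorem IsDet.dagger_comp_comp {f : P ⟶ Q} {g : Q ⟶ R} (h : IsDet (f ≫ g)) :
    dagger f ≫ f ≫ g = g := by
  have retraction : dagger g ≫ dagger f ≫ f ≫ g = 𝟙 R := by
    rw [← Category.assoc, ← dagger_comp, h.dagger_comp_self]
  rw [← dagger_eq_of_comp_eq_id retraction, dagger_dagger]

end Dagger

end PS

namespace DynSystem

variable {C : Type u} [Category.{v} C] [MonoidalCategory C] [MarkovCategory C]
  {M : Type w} [Monoid M]

section Causal

variable [IsCausal C] {D : DynSystem C M} {c : Limits.Cocone D}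

/-- The cocone over `D` whose leg is a given invariant morphism. -/
def coconeOfInvariant (D : DynSystem C M) {A : PS C} (f : D.space ⟶ A)
    (hf : ∀ m : M, D.act m ≫ f = f) : Limits.Cocone D where
  pt := A
  ι :=
    { app := fun _ => f
      naturality := fun _ _ m => (hf m).trans (Category.comp_id f).symm }

theorem act_comp_leg (c : Limits.Cocone D) (m : M) : D.act m ≫ leg c = leg c :=
  c.w (SingleObj.toEnd M m)

namespace IsInvariantObject

theorem isDet_leg (hc : IsInvariantObject c) : PS.IsDet (leg c) :=
  (hc.det_iff c (𝟙 _) (Category.comp_id _)).2 (PS.isDet_id _)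

theorem exists_leg_comp_eq (hc : IsInvariantObject c) {A : PS C} {f : D.space ⟶ A}
    (hf : ∀ m : M, D.act m ≫ f = f) : ∃ t : c.pt ⟶ A, leg c ≫ t = f :=
  let ⟨h⟩ := hc.isColimit
  ⟨h.desc (D.coconeOfInvariant f hf), h.fac _ _⟩

end IsInvariantObject

end Causal

section Reversal

variable [HasConditionals C] {D : DynSystem C M} {c : Limits.Cocone D}

/-- The time reversal of `D`: the dynamical system on the same space in which `m` acts by the
Bayesian inverse of its action. Its monoid is `Mᵐᵒᵖ` because inversion reverses composition. -/
noncomputable def reverse (D : DynSystem C M) : DynSystem C Mᵐᵒᵖ where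
  obj _ := D.space
  map {_ _} (m : Mᵐᵒᵖ) := PS.dagger (D.act m.unop)
  map_id _ := (congrArg PS.dagger (D.map_id (SingleObj.star M))).trans (PS.dagger_id _)
  map_comp {_ _ _} (m n : Mᵐᵒᵖ) :=
    (congrArg PS.dagger (D.map_comp (SingleObj.toEnd M n.unop) (SingleObj.toEnd M m.unop))).trans
      (PS.dagger_comp _ _)

namespace IsInvariantObject

theorem dagger_leg_comp_leg (hc : IsInvariantObject c) : PS.dagger (leg c) ≫ leg c = 𝟙 c.pt :=
  hc.isDet_leg.dagger_comp_self

theorem dagger_act_comp_leg (hc : IsInvariantObject c) (m : M) :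
    PS.dagger (D.act m) ≫ leg c = leg c := by
  have det : PS.IsDet (D.act m ≫ leg c) := by rw [act_comp_leg]; exact hc.isDet_leg
  simpa only [act_comp_leg] using det.dagger_comp_comp

theorem isErgodic_dagger_leg (hc : IsInvariantObject c) : IsErgodic c (PS.dagger (leg c)) where
  det := by rw [hc.dagger_leg_comp_leg]; exact PS.isDet_id _
  leftInvariant m := by
    rw [← PS.dagger_dagger (D.act m), ← PS.dagger_comp, hc.dagger_act_comp_leg]

theorem act_comp_leg_reverse {c' : Limits.Cocone D.reverse} (hc' : IsInvariantObject c') (m : M) :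
    D.act m ≫ leg c' = leg c' := by
  have h : PS.dagger (PS.dagger (D.act m)) ≫ leg c' = leg c' :=
    hc'.dagger_act_comp_leg (MulOpposite.op m)
  rwa [PS.dagger_dagger] at h

variable {c' : Limits.Cocone D.reverse}

theorem exists_leg_comp_eq_of_dagger (hc : IsInvariantObject c) (hc' : IsInvariantObject c')
    {A : PS C} {f : D.space ⟶ A} (hf : ∀ m : M, PS.dagger (D.act m) ≫ f = f) :
    ∃ t : c.pt ⟶ A, leg c ≫ t = f := by
  obtain ⟨u, hu⟩ := hc.exists_leg_comp_eq hc'.act_comp_leg_reverse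
  obtain ⟨t, ht⟩ := hc'.exists_leg_comp_eq fun m => hf m.unop
  exact ⟨u ≫ t, by rw [reassoc_of% hu]; exact ht⟩

theorem comp_leg_comp_dagger_leg (hc : IsInvariantObject c) (hc' : IsInvariantObject c')
    {Y : PS C} {g : Y ⟶ D.space} (hg : D.LeftInvariant g) :
    (g ≫ leg c) ≫ PS.dagger (leg c) = g := by
  obtain ⟨t, ht⟩ := hc.exists_leg_comp_eq_of_dagger hc' (f := PS.dagger g) fun m => by
    rw [← PS.dagger_comp, hg m]
  obtain rfl : PS.dagger t ≫ PS.dagger (leg c) = g := by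
    rw [← PS.dagger_comp, ht, PS.dagger_dagger]
  simp only [Category.assoc, reassoc_of% hc.dagger_leg_comp_leg]

theorem comp_dagger_leg_eq_iff (hc : IsInvariantObject c) (hc' : IsInvariantObject c')
    {Y : PS C} {g : Y ⟶ D.space} (hg : D.LeftInvariant g) {t : Y ⟶ c.pt} :
    t ≫ PS.dagger (leg c) = g ↔ t = g ≫ leg c := by
  constructor
  · rintro rfl
    rw [Category.assoc, hc.dagger_leg_comp_leg, Category.comp_id]
  · rintro rfl
    exact hc.comp_leg_comp_dagger_leg hc' hg

end IsInvariantObject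

end Reversal

end DynSystem

end ErgDec

theorem mainTheorem3_general {C : Type u} [Category.{v} C] [MonoidalCategory C]
    [MarkovCategory C] [ErgDec.HasConditionals C] {M : Type w} [Monoid M]
    (D : ErgDec.DynSystem C M)
    (c : Limits.Cocone D) (hc : ErgDec.DynSystem.IsInvariantObject c)
    (c' : Limits.Cocone D.reverse) (hc' : ErgDec.DynSystem.IsInvariantObject c') :
    ErgDec.IsErgodic c (ErgDec.PS.dagger (ErgDec.DynSystem.leg c)) ∧
    (∀ {Y : ErgDec.PS C} (g : Y ⟶ D.space), D.LeftInvariant g →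
      ∃! gt : Y ⟶ c.pt, ∃ h : gt ≫ ErgDec.PS.dagger (ErgDec.DynSystem.leg c) = g,
        (ErgDec.Decomposition.mk c.pt gt (ErgDec.PS.dagger (ErgDec.DynSystem.leg c)) h).Ergodic
          c) ∧
    (∀ {Y : ErgDec.PS C} (g : Y ⟶ D.space), D.LeftInvariant g →
      ∀ (gt : Y ⟶ c.pt) (h : gt ≫ ErgDec.PS.dagger (ErgDec.DynSystem.leg c) = g)
        (E : ErgDec.Decomposition g), E.Ergodic c →
        ∃! d : E.mid ⟶ c.pt, E.IsReduction
          (ErgDec.Decomposition.mk c.pt gt (ErgDec.PS.dagger (ErgDec.DynSystem.leg c)) h) d) := by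
  refine ⟨hc.isErgodic_dagger_leg, fun g hg => ?_, fun g hg gt h E hE => ?_⟩
  · refine ⟨g ≫ ErgDec.DynSystem.leg c,
      ⟨(hc.comp_dagger_leg_eq_iff hc' hg).2 rfl, hc.isErgodic_dagger_leg⟩, ?_⟩
    rintro t ⟨ht, -⟩
    exact (hc.comp_dagger_leg_eq_iff hc' hg).1 ht
  · have snd_iff {d : E.mid ⟶ c.pt} := hc.comp_dagger_leg_eq_iff hc' hE.leftInvariant (t := d)
    have fst_eq : E.fst ≫ E.snd ≫ ErgDec.DynSystem.leg c = gt := by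
      rw [← Category.assoc, E.fac, (hc.comp_dagger_leg_eq_iff hc' hg).1 h]
    exact ⟨E.snd ≫ ErgDec.DynSystem.leg c, ⟨hE.det, snd_iff.2 rfl, fst_eq⟩,
      fun d hd => snd_iff.1 hd.snd_eq⟩

theorem mainTheorem3 {C : Type u} [Category.{v} C] [MonoidalCategory C] [MarkovCategory C]
    [ErgDec.HasConditionals C] (hC : ErgDec.HasInvariantObjects.{w} C)
    {M : Type w} [Monoid M] (D : ErgDec.DynSystem C M)
    (c : Limits.Cocone D) (hc : ErgDec.DynSystem.IsInvariantObject c) :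
    -- the dagger of `r : (X, p) ⟶ (X_inv, p_inv)` is almost surely ergodic
    ErgDec.IsErgodic c (ErgDec.PS.dagger (ErgDec.DynSystem.leg c)) ∧
    -- every left-invariant morphism decomposes uniquely, and ergodically, through it
    (∀ {Y : ErgDec.PS C} (g : Y ⟶ D.space), D.LeftInvariant g →
      ∃! gt : Y ⟶ c.pt, ∃ h : gt ≫ ErgDec.PS.dagger (ErgDec.DynSystem.leg c) = g,
        (ErgDec.Decomposition.mk c.pt gt (ErgDec.PS.dagger (ErgDec.DynSystem.leg c)) h).Ergodic
          c) ∧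
    -- every ergodic decomposition reduces to that one, in a unique way
    (∀ {Y : ErgDec.PS C} (g : Y ⟶ D.space), D.LeftInvariant g →
      ∀ (gt : Y ⟶ c.pt) (h : gt ≫ ErgDec.PS.dagger (ErgDec.DynSystem.leg c) = g)
        (E : ErgDec.Decomposition g), E.Ergodic c →
        ∃! d : E.mid ⟶ c.pt, E.IsReduction
          (ErgDec.Decomposition.mk c.pt gt (ErgDec.PS.dagger (ErgDec.DynSystem.leg c)) h) d) :=
  mainTheorem3_general D c hc _ (hC Mᵐᵒᵖ D.reverse).choose_spec
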